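/- **Theorem 1.** Let $K$ be an infinite field with $\operatorname{char} K\neq 2,3$; all algebras are associative $K$-algebras with $1$. Let $F=K\langle x_1,x_2,\dots\rangle$ be the free algebra of countable rank, let $[a,b]=ab-ba$ and $[a_1,\dots,a_n]=[[a_1,\dots,a_{n-1}],a_n]$ for $n\ge 3$. For $n\ge 2$ let $T^{(n)}$ be the T-ideal of $F$ generated by $[x_1,\dots,x_n]$, i.e. the least two-sided ideal of $F$ that contains $[x_1,\dots,x_n]$ and is stable under all endomorphisms of the algebra $F$. For an algebra $A$ let $T^{(n)}(A)$ be the two-sided ideal of $A$ generated by all elements $\varphi(f)$, where $f\in T^{(n)}$ and $\varphi:F\to A$ is a homomorphism of algebras. If $A$ is generated as an algebra by three (not necessarily distinct) elements, then for all integers $m,n\ge 2$ $$T^{(m)}(A)\cdot T^{(n)}(A)\subseteq T^{(m+n-1)}(A).$$ The restriction on the number of generators is essential: $[x_1,x_2][x_3,x_4]\notin T^{(3)}$ in $F$, and in the free algebra $F_4=K\langle x_1,x_2,x_3,x_4\rangle$ one has $T^{(2)}(F_4)\cdot T^{(2)}(F_4)\not\subseteq T^{(3)}(F_4)$. -/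

import Mathlib

namespace LieNilpotent

/-- The iterated commutator `[x₁, …, xₙ] = [[x₁, …, xₙ₋₁], xₙ]` of the first `n` terms
`x 0, …, x (n - 1)` of a sequence, with `⁅a, b⁆ = a * b - b * a`; the value at `n = 0` is junk. -/
def iterCommutator {R : Type*} [Ring R] (x : ℕ → R) : ℕ → R
  | 0 => 0
  | 1 => x 0
  | n + 2 => ⁅iterCommutator x (n + 1), x (n + 1)⁆

section

variable (K : Type*) [Field K]

/-- A T-ideal of the free unital associative algebra of countable rank: a two-sided ideal that is
stable under all algebra endomorphisms. -/
def IsTIdeal (I : TwoSidedIdeal (FreeAlgebra K ℕ)) : Prop :=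
  ∀ φ : FreeAlgebra K ℕ →ₐ[K] FreeAlgebra K ℕ, ∀ f ∈ I, φ f ∈ I

/-- The T-ideal generated by a set of polynomials: the least T-ideal containing it. -/
def tIdealSpan (S : Set (FreeAlgebra K ℕ)) : TwoSidedIdeal (FreeAlgebra K ℕ) :=
  sInf {I | IsTIdeal K I ∧ ∀ f ∈ S, f ∈ I}

/-- `T⁽ⁿ⁾`, the T-ideal of the free algebra generated by `[x₁, …, xₙ]`. -/
def T (n : ℕ) : TwoSidedIdeal (FreeAlgebra K ℕ) :=
  tIdealSpan K {iterCommutator (FreeAlgebra.ι K) n}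

/-- `T⁽ⁿ⁾(A)`: the two-sided ideal of `A` generated by all values in `A` of all polynomials
of `T⁽ⁿ⁾`. -/
def TOf (A : Type*) [Ring A] [Algebra K A] (n : ℕ) : TwoSidedIdeal A :=
  TwoSidedIdeal.span {a | ∃ f ∈ T K n, ∃ φ : FreeAlgebra K ℕ →ₐ[K] A, φ f = a}

end

end LieNilpotent

/-! Write `L n` for `lowerCentral K A n` and `M n` for the ideal it generates. Then `T⁽ⁿ⁺¹⁾(A) = M
n`, and the claim becomes `M i * M j ≤ M (i + j)`. The heart is `M (k+1) * M 1 ≤ M (k+2)`. For `w ∈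
L k` the product `[w,a][v,b]` is, modulo `M (k+2)`, alternating in `a, v, b`, so on three generators
it has essentially one value, `[w,x₁][x₂,x₃]`. Three times this value is congruent to `[w,s]`, where
`s` is the standard cubic in the generators. Now `s` is central modulo `M 2`, and `[M 2, A] ⊆ L 3`
(this uses 2 and 3 invertible), so bracketing with `s` raises the degree by two and `[w,s] ∈ M
(k+2)`. The Leibniz rule passes from generators to all arguments. It follows that `[M n, A] ⊆ M
(n+1)`, and `l[u,d] = [lu,d] - [l,d]u` gives the general product by induction on `j`. For four
generators, the exterior algebra on `K⁴` kills `T⁽³⁾` but not `[e₀,e₁][e₂,e₃]`. -/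

namespace LieNilpotent

/-! ### Lower central series and the ideals it generates -/

section LowerCentral

variable (K : Type*) [Field K] (A : Type*) [Ring A] [Algebra K A]

/-- The lower central series of `A` as a Lie algebra, starting with `lowerCentral K A 0 = A`. -/
def lowerCentral : ℕ → Submodule K A
  | 0 => ⊤
  | n + 1 => Submodule.span K {x | ∃ l ∈ lowerCentral n, ∃ a : A, ⁅l, a⁆ = x}

/-- The left ideal generated by the `n`-th term of the lower central series of `A`. -/
def commutatorIdeal (n : ℕ) : Ideal A :=
  Ideal.span (lowerCentral K A n : Set A)

variable {K A}

theorem lie_mem_lowerCentral {n : ℕ} {l : A} (hl : l ∈ lowerCentral K A n) (a : A) :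
    ⁅l, a⁆ ∈ lowerCentral K A (n + 1) :=
  Submodule.subset_span ⟨l, hl, a, rfl⟩

theorem mem_lowerCentral_zero (a : A) : a ∈ lowerCentral K A 0 :=
  Submodule.mem_top

theorem lie_mem_lowerCentral_one (a b : A) : ⁅a, b⁆ ∈ lowerCentral K A 1 :=
  lie_mem_lowerCentral (mem_lowerCentral_zero a) b

theorem lowerCentral_succ_le_iff {n : ℕ} {N : Submodule K A} :
    lowerCentral K A (n + 1) ≤ N ↔ ∀ l ∈ lowerCentral K A n, ∀ a : A, ⁅l, a⁆ ∈ N := by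
  refine ⟨fun h l hl a => h (lie_mem_lowerCentral hl a), fun h => ?_⟩
  refine Submodule.span_le.2 ?_
  rintro _ ⟨l, hl, a, rfl⟩
  exact h l hl a

theorem lowerCentral_succ_le (n : ℕ) : lowerCentral K A (n + 1) ≤ lowerCentral K A n := by
  induction n with
  | zero => exact le_top
  | succ n ih => exact lowerCentral_succ_le_iff.2 fun l hl a => lie_mem_lowerCentral (ih hl) a

variable (K) in
/-- The inner derivation `x ↦ ⁅x, a⁆` as a linear map. -/
def lieRight (a : A) : A →ₗ[K] A :=
  LinearMap.mulRight K a - LinearMap.mulLeft K a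

@[simp]
theorem lieRight_apply (a x : A) : lieRight K a x = ⁅x, a⁆ :=
  rfl

theorem lie_swap (a b : A) : ⁅a, b⁆ = -⁅b, a⁆ := by
  simp only [Ring.lie_def]; noncomm_ring

theorem lie_lie_right (l m a : A) : ⁅l, ⁅m, a⁆⁆ = ⁅⁅l, m⁆, a⁆ - ⁅⁅l, a⁆, m⁆ := by
  simp only [Ring.lie_def]; noncomm_ring

theorem mul_lie_right (a b c : A) : ⁅a * b, c⁆ = a * ⁅b, c⁆ + ⁅a, c⁆ * b := by
  simp only [Ring.lie_def]; noncomm_ring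

theorem add_lie_ring (a b c : A) : ⁅a + b, c⁆ = ⁅a, c⁆ + ⁅b, c⁆ := by
  simp only [Ring.lie_def]; noncomm_ring

theorem lie_add_ring (a b c : A) : ⁅a, b + c⁆ = ⁅a, b⁆ + ⁅a, c⁆ := by
  simp only [Ring.lie_def]; noncomm_ring

theorem lie_self_ring (a : A) : ⁅a, a⁆ = 0 := by
  simp only [Ring.lie_def, sub_self]

theorem lie_algebraMap (a : A) (r : K) : ⁅a, algebraMap K A r⁆ = 0 := by
  rw [Ring.lie_def, Algebra.commutes, sub_self]

theorem algebraMap_lie (a : A) (r : K) : ⁅algebraMap K A r, a⁆ = 0 := by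
  rw [lie_swap, lie_algebraMap, neg_zero]

theorem lie_mem_lowerCentral_add {i j : ℕ} {l m : A} (hl : l ∈ lowerCentral K A i)
    (hm : m ∈ lowerCentral K A j) : ⁅l, m⁆ ∈ lowerCentral K A (i + j + 1) := by
  induction j generalizing i l m with
  | zero => exact lie_mem_lowerCentral hl m
  | succ j ih =>
    have key : lowerCentral K A (j + 1) ≤
        (lowerCentral K A (i + (j + 1) + 1)).comap (lieRight K l) := by
      refine lowerCentral_succ_le_iff.2 fun m hm a => ?_
      rw [Submodule.mem_comap, lieRight_apply, lie_swap, lie_lie_right]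
      refine neg_mem (sub_mem (lie_mem_lowerCentral (ih hl hm) a) ?_)
      have := ih (lie_mem_lowerCentral hl a) hm
      rwa [show i + (j + 1) + 1 = i + 1 + j + 1 by ring]
    rw [lie_swap]
    exact neg_mem (key hm)

section CommutatorIdeal

theorem mem_commutatorIdeal {n : ℕ} {l : A} (hl : l ∈ lowerCentral K A n) :
    l ∈ commutatorIdeal K A n :=
  Ideal.subset_span hl

theorem commutatorIdeal_le_iff {n : ℕ} {I : Ideal A} :
    commutatorIdeal K A n ≤ I ↔ ∀ l ∈ lowerCentral K A n, l ∈ I :=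
  Ideal.span_le

theorem smul_mem_ideal (I : Ideal A) (r : K) {x : A} (hx : x ∈ I) : r • x ∈ I := by
  rw [Algebra.smul_def]
  exact I.mul_mem_left _ hx

/-- Since `la = al + [l,a]` and the series is decreasing, the left ideal is also a right ideal. -/
theorem commutatorIdeal_mul_mem {n : ℕ} {x : A} (hx : x ∈ commutatorIdeal K A n) (a : A) :
    x * a ∈ commutatorIdeal K A n := by
  induction hx using Submodule.span_induction with
  | mem l hl =>
    have h : l * a = a * l + ⁅l, a⁆ := by simp only [Ring.lie_def]; noncomm_ring
    rw [h]
    exact add_mem (Ideal.mul_mem_left _ _ (mem_commutatorIdeal hl))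
      (mem_commutatorIdeal (lowerCentral_succ_le n (lie_mem_lowerCentral hl a)))
  | zero => rw [zero_mul]; exact zero_mem _
  | add x y _ _ hx hy => rw [add_mul]; exact add_mem hx hy
  | smul b x _ hx => rw [smul_eq_mul, mul_assoc]; exact Ideal.mul_mem_left _ _ hx

instance (n : ℕ) : (commutatorIdeal K A n).IsTwoSided :=
  ⟨fun b hx => commutatorIdeal_mul_mem hx b⟩

theorem commutatorIdeal_succ_le (n : ℕ) : commutatorIdeal K A (n + 1) ≤ commutatorIdeal K A n :=
  Ideal.span_mono (lowerCentral_succ_le n)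

/-- A product of ideals `commutatorIdeal K A i` and `commutatorIdeal K A j` lies in a two-sided
ideal if the products of elements of the lower central series do. -/
theorem commutatorIdeal_mul_le {i j : ℕ} {I : Ideal A}
    (h : ∀ l ∈ lowerCentral K A i, ∀ m ∈ lowerCentral K A j, l * m ∈ I) :
    commutatorIdeal K A i * commutatorIdeal K A j ≤ I := by
  rw [Ideal.mul_le]
  intro x hx y hy
  have hl : ∀ l ∈ lowerCentral K A j, ∀ x ∈ commutatorIdeal K A i, x * l ∈ I := by
    intro l hl x hx
    induction hx using Submodule.span_induction with
    | mem m hm => exact h m hm l hl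
    | zero => rw [zero_mul]; exact zero_mem _
    | add x y _ _ hx hy => rw [add_mul]; exact add_mem hx hy
    | smul b x _ hx => rw [smul_eq_mul, mul_assoc]; exact Ideal.mul_mem_left _ _ hx
  induction hy using Submodule.span_induction generalizing x with
  | mem l hl' => exact hl l hl' x hx
  | zero => rw [mul_zero]; exact zero_mem _
  | add y z _ _ hy hz => rw [mul_add]; exact add_mem (hy x hx) (hz x hx)
  | smul b y _ hy => rw [smul_eq_mul, ← mul_assoc]; exact hy _ (commutatorIdeal_mul_mem hx b)

end CommutatorIdeal

/-! ### Brackets with the ideal of triple commutators -/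

section TripleCommutators

variable (h2 : (2 : K) ≠ 0) (h3 : (3 : K) ≠ 0)

/-- The element `[[q, z, a] ∘ y, b]` with the Jordan product `u ∘ v = u * v + v * u`. -/
def lieJordan (q z a y b : A) : A :=
  ⁅⁅⁅q, z⁆, a⁆ * y + y * ⁅⁅q, z⁆, a⁆, b⁆

theorem lieJordan_swap_last (q z a y b : A) :
    lieJordan q z a y b + lieJordan q z a b y ∈ lowerCentral K A 3 := by
  have h : lieJordan q z a y b + lieJordan q z a b y = ⁅⁅⁅q, z⁆, a⁆, y * b + b * y⁆ := by
    simp only [lieJordan, Ring.lie_def]; noncomm_ring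
  rw [h]
  exact lie_mem_lowerCentral (lie_mem_lowerCentral (lie_mem_lowerCentral_one _ _) _) _

theorem lieJordan_swap_middle (q z a y b : A) :
    lieJordan q z a y b + lieJordan q z y a b ∈ lowerCentral K A 3 := by
  have h : lieJordan q z a y b + lieJordan q z y a b = ⁅⁅⁅q, z⁆, a * y + y * a⁆, b⁆ := by
    simp only [lieJordan, Ring.lie_def]; noncomm_ring
  rw [h]
  exact lie_mem_lowerCentral (lie_mem_lowerCentral (lie_mem_lowerCentral_one _ _) _) _

theorem lieJordan_cyclic (q z a y b : A) :
    lieJordan q z a y b + lieJordan q a y z b + lieJordan q y z a b ∈ lowerCentral K A 3 := by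
  have h : lieJordan q z a y b + lieJordan q a y z b + lieJordan q y z a b =
      ⁅⁅⁅q * y + y * q, z⁆, a⁆, b⁆ + ⁅⁅⁅q * z + z * q, a⁆, y⁆, b⁆ +
        ⁅⁅⁅q * a + a * q, y⁆, z⁆, b⁆ := by
    simp only [lieJordan, Ring.lie_def]; noncomm_ring
  rw [h]
  have (u v w t : A) : ⁅⁅⁅u, v⁆, w⁆, t⁆ ∈ lowerCentral K A 3 :=
    lie_mem_lowerCentral (lie_mem_lowerCentral (lie_mem_lowerCentral_one _ _) _) _
  exact add_mem (add_mem (this _ _ _ _) (this _ _ _ _)) (this _ _ _ _)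

include h3 in
-- Modulo `L 3` the expression is alternating in `a, y, b` and has vanishing cyclic sum over `z, a,
-- y`. Up to sign only four values remain, one for each choice of the entry next to `q`, and any
-- three of them satisfy a signed linear relation.
theorem lieJordan_mem (q z a y b : A) : lieJordan q z a y b ∈ lowerCentral K A 3 := by
  have s1 (z a y b : A) := (Submodule.Quotient.mk_eq_zero _).2
    (lieJordan_swap_last (K := K) q z a y b)
  have s2 (z a y b : A) := (Submodule.Quotient.mk_eq_zero _).2
    (lieJordan_swap_middle (K := K) q z a y b)
  have c (z a y b : A) := (Submodule.Quotient.mk_eq_zero _).2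
    (lieJordan_cyclic (K := K) q z a y b)
  simp only [Submodule.Quotient.mk_add] at s1 s2 c
  rw [← Submodule.Quotient.mk_eq_zero]
  set X : A → A → A → A → A ⧸ lowerCentral K A 3 :=
    fun z a y b => Submodule.Quotient.mk (lieJordan q z a y b)
  change ∀ z a y b, X z a y b + X z a b y = 0 at s1
  change ∀ z a y b, X z a y b + X z y a b = 0 at s2
  change ∀ z a y b, X z a y b + X a y z b + X y z a b = 0 at c
  change X z a y b = 0
  have cyc (z a y b : A) : X z y b a = X z a y b := by
    rw [eq_neg_of_add_eq_zero_left (s2 z a y b), eq_neg_of_add_eq_zero_left (s1 z y a b), neg_neg]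
  have h : (3 : K) • X z a y b = 0 := by
    -- The three cyclic relations containing the value at `z`, plus twice the one without it: the
    -- other values cancel.
    linear_combination (norm := module) c z a y b + c z y b a + c z b a y + (2 : K) • c a y b z
      - (2 : K) • cyc z a y b - cyc z y b a - cyc y b z a - cyc b a z y - cyc a y z b
      - (2 : K) • s1 a y b z - (2 : K) • s1 y b a z - (2 : K) • s1 b a y z
  exact (smul_eq_zero.1 h).resolve_left h3

include h2 h3 in
theorem mul_lie_mem_of_mem_lowerCentral {l : A} (hl : l ∈ lowerCentral K A 2) (y b : A) :
    ⁅y * l, b⁆ ∈ lowerCentral K A 3 := by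
  have key : lowerCentral K A 2 ≤
      (lowerCentral K A 3).comap (lieRight K b ∘ₗ LinearMap.mulLeft K y) := by
    refine lowerCentral_succ_le_iff.2 fun p hp a => ?_
    have key : lowerCentral K A 1 ≤
        (lowerCentral K A 3).comap (lieRight K b ∘ₗ LinearMap.mulLeft K y ∘ₗ lieRight K a) := by
      refine lowerCentral_succ_le_iff.2 fun q _ z => ?_
      change ⁅y * ⁅⁅q, z⁆, a⁆, b⁆ ∈ lowerCentral K A 3
      -- From `2yl = (ly + yl) - [l,y]` with `l = [q,z,a]`.
      have h : (2 : K) • ⁅y * ⁅⁅q, z⁆, a⁆, b⁆ = lieJordan q z a y b - ⁅⁅⁅⁅q, z⁆, a⁆, y⁆, b⁆ := by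
        rw [two_smul]
        simp only [lieJordan, Ring.lie_def]; noncomm_ring
      rw [← (lowerCentral K A 3).smul_mem_iff h2, h]
      refine sub_mem (lieJordan_mem h3 q z a y b) ?_
      exact lie_mem_lowerCentral (lowerCentral_succ_le 2 (lie_mem_lowerCentral
        (lie_mem_lowerCentral (lie_mem_lowerCentral_one _ _) _) _)) _
    exact key hp
  exact key hl

include h2 h3 in
theorem lie_mem_of_mem_commutatorIdeal {c : A} (hc : c ∈ commutatorIdeal K A 2) (b : A) :
    ⁅c, b⁆ ∈ lowerCentral K A 3 := by
  have key (y : A) : ⁅y * c, b⁆ ∈ lowerCentral K A 3 := by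
    induction hc using Submodule.span_induction generalizing y with
    | mem l hl => exact mul_lie_mem_of_mem_lowerCentral h2 h3 hl y b
    | zero => rw [mul_zero, Ring.lie_def, zero_mul, mul_zero, sub_zero]; exact zero_mem _
    | add x z _ _ hx hz => rw [mul_add, add_lie_ring]; exact add_mem (hx y) (hz y)
    | smul a x _ hx => rw [smul_eq_mul, ← mul_assoc]; exact hx _
  simpa using key 1

include h2 h3 in
theorem lie_mem_of_mem_commutatorIdeal_of_mem {c : A} (hc : c ∈ commutatorIdeal K A 2) {k : ℕ}
    {l : A} (hl : l ∈ lowerCentral K A k) : ⁅l, c⁆ ∈ lowerCentral K A (k + 3) := by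
  induction k generalizing l with
  | zero =>
    rw [lie_swap]
    exact neg_mem (lie_mem_of_mem_commutatorIdeal h2 h3 hc l)
  | succ k ih =>
    have key : lowerCentral K A (k + 1) ≤
        (lowerCentral K A (k + 1 + 3)).comap (lieRight K c) := by
      refine lowerCentral_succ_le_iff.2 fun m hm a => ?_
      have h : ⁅⁅m, a⁆, c⁆ = ⁅⁅m, c⁆, a⁆ - ⁅m, ⁅c, a⁆⁆ := by
        rw [lie_lie_right]; abel
      rw [Submodule.mem_comap, lieRight_apply, h, show k + 1 + 3 = k + 3 + 1 by ring]
      exact sub_mem (lie_mem_lowerCentral (ih hm) a)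
        (lie_mem_lowerCentral_add hm (lie_mem_of_mem_commutatorIdeal h2 h3 hc a))
    exact key hl

end TripleCommutators

/-! ### The product theorem for three generators -/

section ThreeGenerators

/-- The standard polynomial of degree three. -/
def standardCubic (a b c : A) : A :=
  a * ⁅b, c⁆ + b * ⁅c, a⁆ + c * ⁅a, b⁆

theorem standardCubic_rotate (a b c : A) : standardCubic a b c = standardCubic b c a := by
  rw [standardCubic, standardCubic]; abel

theorem lie_standardCubic_mem_of_eq (a b c : A) :
    ⁅a, standardCubic a b c⁆ ∈ commutatorIdeal K A 2 := by
  have h : ⁅a, standardCubic a b c⁆ =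
      a * ⁅⁅c, b⁆, a⁆ + b * ⁅⁅a, c⁆, a⁆ + c * ⁅⁅b, a⁆, a⁆ + ⁅⁅a, b⁆, ⁅c, a⁆⁆ := by
    simp only [standardCubic, Ring.lie_def]; noncomm_ring
  have hl (u v w : A) : ⁅⁅u, v⁆, w⁆ ∈ commutatorIdeal K A 2 :=
    mem_commutatorIdeal (lie_mem_lowerCentral (lie_mem_lowerCentral_one _ _) _)
  rw [h]
  exact add_mem (add_mem (add_mem (Ideal.mul_mem_left _ _ (hl _ _ _))
    (Ideal.mul_mem_left _ _ (hl _ _ _))) (Ideal.mul_mem_left _ _ (hl _ _ _))) (hl _ _ _)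

variable {x₁ x₂ x₃ : A} (hx : Algebra.adjoin K {x₁, x₂, x₃} = ⊤)

include hx in
/-- To prove a property of all elements of an algebra that is stable under linear combinations and
products it suffices to check the generators. -/
theorem induction_of_adjoin_eq_top {p : A → Prop} (h₁ : p x₁) (h₂ : p x₂) (h₃ : p x₃)
    (algebraMap : ∀ r : K, p (algebraMap K A r)) (add : ∀ a b, p a → p b → p (a + b))
    (mul : ∀ a b, p a → p b → p (a * b)) (a : A) : p a := by
  have ha : a ∈ Algebra.adjoin K {x₁, x₂, x₃} := hx ▸ Algebra.mem_top
  induction ha using Algebra.adjoin_induction with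
  | mem y hy => rcases hy with rfl | rfl | rfl <;> assumption
  | algebraMap r => exact algebraMap r
  | add a b _ _ ha hb => exact add a b ha hb
  | mul a b _ _ ha hb => exact mul a b ha hb

include hx in
-- Cyclic symmetry reduces the generators to one identity; the elements commuting with the cubic
-- modulo the two-sided ideal `M 2` form a subalgebra.
theorem lie_standardCubic_mem (a : A) :
    ⁅a, standardCubic x₁ x₂ x₃⁆ ∈ commutatorIdeal K A 2 := by
  induction a using induction_of_adjoin_eq_top hx with
  | h₁ => exact lie_standardCubic_mem_of_eq _ _ _
  | h₂ => rw [standardCubic_rotate]; exact lie_standardCubic_mem_of_eq _ _ _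
  | h₃ => rw [← standardCubic_rotate]; exact lie_standardCubic_mem_of_eq _ _ _
  | algebraMap r => rw [algebraMap_lie]; exact zero_mem _
  | add a b ha hb => rw [add_lie_ring]; exact add_mem ha hb
  | mul a b ha hb =>
    rw [mul_lie_right]
    exact add_mem (Ideal.mul_mem_left _ _ hb) (commutatorIdeal_mul_mem ha b)

variable (h2 : (2 : K) ≠ 0) (h3 : (3 : K) ≠ 0)

include hx h2 h3 in
-- By Jacobi, from `[A,s] ⊆ M 2` and `[L k, M 2] ⊆ L (k+3)`. The series index starts at one because
-- `[A,s]` is only known to lie in the ideal `M 2`, not in `L 2`.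
theorem lie_standardCubic_mem_lowerCentral {k : ℕ} {l : A} (hl : l ∈ lowerCentral K A (k + 1)) :
    ⁅l, standardCubic x₁ x₂ x₃⁆ ∈ lowerCentral K A (k + 3) := by
  induction k generalizing l with
  | zero =>
    have key : lowerCentral K A 1 ≤
        (lowerCentral K A 3).comap (lieRight K (standardCubic x₁ x₂ x₃)) := by
      refine lowerCentral_succ_le_iff.2 fun m _ a => ?_
      have h (s : A) : ⁅⁅m, a⁆, s⁆ = ⁅⁅m, s⁆, a⁆ - ⁅⁅a, s⁆, m⁆ := by
        simp only [Ring.lie_def]; noncomm_ring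
      rw [Submodule.mem_comap, lieRight_apply, h]
      exact sub_mem
        (lie_mem_of_mem_commutatorIdeal h2 h3 (lie_standardCubic_mem hx m) a)
        (lie_mem_of_mem_commutatorIdeal h2 h3 (lie_standardCubic_mem hx a) m)
    exact key hl
  | succ k ih =>
    have key : lowerCentral K A (k + 1 + 1) ≤
        (lowerCentral K A (k + 1 + 3)).comap (lieRight K (standardCubic x₁ x₂ x₃)) := by
      refine lowerCentral_succ_le_iff.2 fun m hm a => ?_
      have h (s : A) : ⁅⁅m, a⁆, s⁆ = ⁅⁅m, s⁆, a⁆ + ⁅m, ⁅a, s⁆⁆ := by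
        rw [lie_lie_right]; abel
      rw [Submodule.mem_comap, lieRight_apply, h]
      exact add_mem (lie_mem_lowerCentral (ih hm) a) (lie_mem_of_mem_commutatorIdeal_of_mem h2 h3
        (lie_standardCubic_mem hx a) hm)
    exact key hl

include hx h2 h3 in
theorem lie_standardCubic_mem_commutatorIdeal {k : ℕ} {l : A} (hl : l ∈ lowerCentral K A k) :
    ⁅l, standardCubic x₁ x₂ x₃⁆ ∈ commutatorIdeal K A (k + 2) := by
  cases k with
  | zero => exact lie_standardCubic_mem hx l
  | succ k => exact mem_commutatorIdeal (lie_standardCubic_mem_lowerCentral hx h2 h3 hl)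

variable {k : ℕ} {w : A} (hw : w ∈ lowerCentral K A k)

include hw in
theorem lie_lie_mem_commutatorIdeal (a b : A) : ⁅w, ⁅a, b⁆⁆ ∈ commutatorIdeal K A (k + 2) :=
  mem_commutatorIdeal (lie_mem_lowerCentral_add hw (lie_mem_lowerCentral_one a b))

include h2 hw in
-- Bracket `[v,a²] = 2a[v,a] + [[v,a],a]` with `w`: all terms other than `2[w,a][v,a]` involve `w`
-- bracketed with a commutator.
theorem lie_mul_lie_self_mem (a v : A) : ⁅w, a⁆ * ⁅v, a⁆ ∈ commutatorIdeal K A (k + 2) := by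
  have h : (2 : K) • (⁅w, a⁆ * ⁅v, a⁆) =
      ⁅w, ⁅v, a * a⁆⁆ - ⁅w, ⁅⁅v, a⁆, a⁆⁆ - (2 : A) * (a * ⁅w, ⁅v, a⁆⁆) := by
    rw [two_smul]
    simp only [Ring.lie_def]; noncomm_ring
  have h' : (2 : K)⁻¹ • ((2 : K) • (⁅w, a⁆ * ⁅v, a⁆)) ∈ commutatorIdeal K A (k + 2) := by
    refine smul_mem_ideal _ _ ?_
    rw [h]
    exact sub_mem (sub_mem (lie_lie_mem_commutatorIdeal hw _ _)
      (lie_lie_mem_commutatorIdeal hw _ _)) (Ideal.mul_mem_left _ _ (Ideal.mul_mem_left _ _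
        (lie_lie_mem_commutatorIdeal hw _ _)))
  rwa [smul_smul, inv_mul_cancel₀ h2, one_smul] at h'

include h2 hw in
theorem lie_mul_lie_add_swap_mem (a v b : A) :
    ⁅w, a⁆ * ⁅v, b⁆ + ⁅w, b⁆ * ⁅v, a⁆ ∈ commutatorIdeal K A (k + 2) := by
  have h : ⁅w, a⁆ * ⁅v, b⁆ + ⁅w, b⁆ * ⁅v, a⁆ =
      ⁅w, a + b⁆ * ⁅v, a + b⁆ - ⁅w, a⁆ * ⁅v, a⁆ - ⁅w, b⁆ * ⁅v, b⁆ := by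
    simp only [Ring.lie_def]; noncomm_ring
  rw [h]
  exact sub_mem (sub_mem (lie_mul_lie_self_mem h2 hw _ _) (lie_mul_lie_self_mem h2 hw _ _))
    (lie_mul_lie_self_mem h2 hw _ _)

include h2 hw in
theorem lie_mul_lie_rotate_mem (a v b : A) :
    ⁅w, a⁆ * ⁅v, b⁆ - ⁅w, v⁆ * ⁅b, a⁆ ∈ commutatorIdeal K A (k + 2) := by
  have h : ⁅w, a⁆ * ⁅v, b⁆ - ⁅w, v⁆ * ⁅b, a⁆ =
      -(⁅w, a⁆ * ⁅b, v⁆ + ⁅w, v⁆ * ⁅b, a⁆) := by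
    simp only [Ring.lie_def]; noncomm_ring
  rw [h]
  exact neg_mem (lie_mul_lie_add_swap_mem h2 hw _ _ _)

include hx h2 h3 hw in
theorem lie_mul_lie_generators_mem : ⁅w, x₁⁆ * ⁅x₂, x₃⁆ ∈ commutatorIdeal K A (k + 2) := by
  have h : (3 : K) • (⁅w, x₁⁆ * ⁅x₂, x₃⁆) = ⁅w, standardCubic x₁ x₂ x₃⁆
      - (x₁ * ⁅w, ⁅x₂, x₃⁆⁆ + x₂ * ⁅w, ⁅x₃, x₁⁆⁆ + x₃ * ⁅w, ⁅x₁, x₂⁆⁆)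
      + (⁅w, x₁⁆ * ⁅x₂, x₃⁆ - ⁅w, x₂⁆ * ⁅x₃, x₁⁆)
      + (⁅w, x₁⁆ * ⁅x₂, x₃⁆ - ⁅w, x₂⁆ * ⁅x₃, x₁⁆ + (⁅w, x₂⁆ * ⁅x₃, x₁⁆ - ⁅w, x₃⁆ * ⁅x₁, x₂⁆)) := by
    rw [show (3 : K) = 2 + 1 by norm_num, add_smul, two_smul, one_smul]
    simp only [standardCubic, Ring.lie_def]; noncomm_ring
  have h' : (3 : K)⁻¹ • ((3 : K) • (⁅w, x₁⁆ * ⁅x₂, x₃⁆)) ∈ commutatorIdeal K A (k + 2) := by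
    refine smul_mem_ideal _ _ ?_
    have hr := lie_mul_lie_rotate_mem h2 hw
    have hl (a b c : A) : a * ⁅w, ⁅b, c⁆⁆ ∈ commutatorIdeal K A (k + 2) :=
      Ideal.mul_mem_left _ _ (lie_lie_mem_commutatorIdeal hw _ _)
    rw [h]
    exact add_mem (add_mem (sub_mem (lie_standardCubic_mem_commutatorIdeal hx h2 h3 hw)
      (add_mem (add_mem (hl _ _ _) (hl _ _ _)) (hl _ _ _))) (hr _ _ _))
      (add_mem (hr _ _ _) (hr _ _ _))
  rwa [smul_smul, inv_mul_cancel₀ h3, one_smul] at h'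

include hx h2 h3 hw in
theorem lie_mul_lie_mem (a v b : A) : ⁅w, a⁆ * ⁅v, b⁆ ∈ commutatorIdeal K A (k + 2) := by
  have swap {a v b : A} (h : ⁅w, a⁆ * ⁅v, b⁆ ∈ commutatorIdeal K A (k + 2)) :
      ⁅w, a⁆ * ⁅b, v⁆ ∈ commutatorIdeal K A (k + 2) := by
    rw [lie_swap b v, mul_neg]
    exact neg_mem h
  have rot {a v b : A} (h : ⁅w, a⁆ * ⁅v, b⁆ ∈ commutatorIdeal K A (k + 2)) :
      ⁅w, v⁆ * ⁅b, a⁆ ∈ commutatorIdeal K A (k + 2) :=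
    (Submodule.sub_mem_iff_right _ h).1 (lie_mul_lie_rotate_mem h2 hw a v b)
  have rep (a v : A) : ⁅w, a⁆ * ⁅v, a⁆ ∈ commutatorIdeal K A (k + 2) :=
    lie_mul_lie_self_mem h2 hw a v
  have self (a v : A) : ⁅w, a⁆ * ⁅v, v⁆ ∈ commutatorIdeal K A (k + 2) := by
    rw [lie_self_ring, mul_zero]; exact zero_mem _
  -- each argument separately may be replaced by a generator
  have step (v b : A) (h₁ : ⁅w, x₁⁆ * ⁅v, b⁆ ∈ commutatorIdeal K A (k + 2))
      (h₂ : ⁅w, x₂⁆ * ⁅v, b⁆ ∈ commutatorIdeal K A (k + 2))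
      (h₃ : ⁅w, x₃⁆ * ⁅v, b⁆ ∈ commutatorIdeal K A (k + 2)) (a : A) :
      ⁅w, a⁆ * ⁅v, b⁆ ∈ commutatorIdeal K A (k + 2) := by
    induction a using induction_of_adjoin_eq_top hx with
    | h₁ => exact h₁
    | h₂ => exact h₂
    | h₃ => exact h₃
    | algebraMap r => rw [lie_algebraMap, zero_mul]; exact zero_mem _
    | add a c ha hc => rw [lie_add_ring, add_mul]; exact add_mem ha hc
    | mul a c ha hc =>
      have h : ⁅w, a * c⁆ * ⁅v, b⁆ =
          a * (⁅w, c⁆ * ⁅v, b⁆) + c * (⁅w, a⁆ * ⁅v, b⁆) + ⁅⁅w, a⁆, c⁆ * ⁅v, b⁆ := by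
        simp only [Ring.lie_def]; noncomm_ring
      rw [h]
      refine add_mem (add_mem (Ideal.mul_mem_left _ _ hc) (Ideal.mul_mem_left _ _ ha)) ?_
      exact commutatorIdeal_mul_mem (mem_commutatorIdeal
        (lie_mem_lowerCentral (lie_mem_lowerCentral hw a) c)) _
  have g := lie_mul_lie_generators_mem hx h2 h3 hw
  -- Free the arguments one at a time, using `rot` to bring the one being freed into the first slot,
  -- where `step` applies; repeated arguments give elements of the ideal.
  have h12 (a : A) : ⁅w, a⁆ * ⁅x₁, x₂⁆ ∈ commutatorIdeal K A (k + 2) :=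
    step _ _ (swap (rep _ _)) (rep _ _) (rot (rot g)) a
  have h23 (a : A) : ⁅w, a⁆ * ⁅x₂, x₃⁆ ∈ commutatorIdeal K A (k + 2) :=
    step _ _ g (swap (rep _ _)) (rep _ _) a
  have h13 (a : A) : ⁅w, a⁆ * ⁅x₁, x₃⁆ ∈ commutatorIdeal K A (k + 2) :=
    step _ _ (swap (rep _ _)) (swap (rot g)) (rep _ _) a
  have hb₁ (b a : A) : ⁅w, b⁆ * ⁅x₁, a⁆ ∈ commutatorIdeal K A (k + 2) :=
    step _ _ (rot (self _ _)) (rot (swap (h12 a))) (rot (swap (h13 a))) b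
  have hb₂ (b a : A) : ⁅w, b⁆ * ⁅x₂, a⁆ ∈ commutatorIdeal K A (k + 2) :=
    step _ _ (rot (h12 a)) (rot (self _ _)) (rot (swap (h23 a))) b
  have hb₃ (b a : A) : ⁅w, b⁆ * ⁅x₃, a⁆ ∈ commutatorIdeal K A (k + 2) :=
    step _ _ (rot (h13 a)) (rot (h23 a)) (rot (self _ _)) b
  exact step v b (rot (hb₁ b v)) (rot (hb₂ b v)) (rot (hb₃ b v)) a

include hx h2 h3 in
theorem commutatorIdeal_mul_one_le (i : ℕ) :
    commutatorIdeal K A i * commutatorIdeal K A 1 ≤ commutatorIdeal K A (i + 1) := by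
  refine commutatorIdeal_mul_le fun l hl m hm => ?_
  cases i with
  | zero => exact Ideal.mul_mem_left _ _ (mem_commutatorIdeal hm)
  | succ k =>
    have key : lowerCentral K A 1 ≤ ((commutatorIdeal K A (k + 1 + 1)).restrictScalars K).comap
        (LinearMap.mulLeft K l) := by
      refine lowerCentral_succ_le_iff.2 fun v _ b => ?_
      have key : lowerCentral K A (k + 1) ≤
          ((commutatorIdeal K A (k + 1 + 1)).restrictScalars K).comap
            (LinearMap.mulRight K ⁅v, b⁆) :=
        lowerCentral_succ_le_iff.2 fun w hw a => lie_mul_lie_mem hx h2 h3 hw a v b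
      exact key hl
    exact key hm

include hx h2 h3 in
theorem lie_mem_commutatorIdeal_succ {n : ℕ} {c : A} (hc : c ∈ commutatorIdeal K A n) (d : A) :
    ⁅c, d⁆ ∈ commutatorIdeal K A (n + 1) := by
  have key (y : A) : ⁅y * c, d⁆ ∈ commutatorIdeal K A (n + 1) := by
    induction hc using Submodule.span_induction generalizing y with
    | mem l hl =>
      -- Only `l[y,d]` is not visibly in `M (n+1)`; it is covered by `M n * M 1 ≤ M (n+1)`.
      have h : ⁅y * l, d⁆ = y * ⁅l, d⁆ + l * ⁅y, d⁆ - ⁅l, ⁅y, d⁆⁆ := by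
        simp only [Ring.lie_def]; noncomm_ring
      rw [h]
      refine sub_mem (add_mem ?_ ?_) ?_
      · exact Ideal.mul_mem_left _ _ (mem_commutatorIdeal (lie_mem_lowerCentral hl d))
      · exact commutatorIdeal_mul_one_le hx h2 h3 n (Ideal.mul_mem_mul (mem_commutatorIdeal hl)
          (mem_commutatorIdeal (lie_mem_lowerCentral_one y d)))
      · exact commutatorIdeal_succ_le _ (lie_lie_mem_commutatorIdeal hl y d)
    | zero => rw [mul_zero, Ring.lie_def, zero_mul, mul_zero, sub_zero]; exact zero_mem _
    | add x z _ _ hx hz => rw [mul_add, add_lie_ring]; exact add_mem (hx y) (hz y)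
    | smul a x _ hx => rw [smul_eq_mul, ← mul_assoc]; exact hx _
  simpa using key 1

include hx h2 h3 in
/-- The product theorem for the ideals generated by the lower central series of an algebra with
three generators. -/
theorem commutatorIdeal_mul_le_add (i j : ℕ) :
    commutatorIdeal K A i * commutatorIdeal K A j ≤ commutatorIdeal K A (i + j) := by
  induction j generalizing i with
  | zero => exact Ideal.mul_le.2 fun x hx y _ => commutatorIdeal_mul_mem hx y
  | succ j ih =>
    refine commutatorIdeal_mul_le fun l hl m hm => ?_
    have key : lowerCentral K A (j + 1) ≤
        ((commutatorIdeal K A (i + (j + 1))).restrictScalars K).comap (LinearMap.mulLeft K l) := by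
      refine lowerCentral_succ_le_iff.2 fun u hu d => ?_
      change l * ⁅u, d⁆ ∈ commutatorIdeal K A (i + (j + 1))
      have h : l * ⁅u, d⁆ = ⁅l * u, d⁆ - ⁅l, d⁆ * u := by
        simp only [Ring.lie_def]; noncomm_ring
      rw [h]
      refine sub_mem ?_ ?_
      · exact lie_mem_commutatorIdeal_succ hx h2 h3
          (ih i (Ideal.mul_mem_mul (mem_commutatorIdeal hl) (mem_commutatorIdeal hu))) d
      · rw [show i + (j + 1) = i + 1 + j by ring]
        exact ih (i + 1) (Ideal.mul_mem_mul (mem_commutatorIdeal (lie_mem_lowerCentral hl d))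
          (mem_commutatorIdeal hu))
    exact key hm

end ThreeGenerators

/-! ### Identification of the T-ideals with the commutator ideals -/

section TIdeals

variable {B : Type*} [Ring B] [Algebra K B]

theorem map_lie_ring (φ : A →ₐ[K] B) (a b : A) : φ ⁅a, b⁆ = ⁅φ a, φ b⁆ := by
  simp only [Ring.lie_def, map_sub, map_mul]

theorem map_mem_lowerCentral (φ : A →ₐ[K] B) {n : ℕ} {l : A} (hl : l ∈ lowerCentral K A n) :
    φ l ∈ lowerCentral K B n := by
  induction n generalizing l with
  | zero => exact mem_lowerCentral_zero _
  | succ n ih =>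
    have key : lowerCentral K A (n + 1) ≤ (lowerCentral K B (n + 1)).comap φ.toLinearMap := by
      refine lowerCentral_succ_le_iff.2 fun m hm a => ?_
      rw [Submodule.mem_comap, AlgHom.toLinearMap_apply, map_lie_ring]
      exact lie_mem_lowerCentral (ih hm) _
    exact key hl

theorem map_mem_commutatorIdeal (φ : A →ₐ[K] B) {n : ℕ} {x : A}
    (hx : x ∈ commutatorIdeal K A n) : φ x ∈ commutatorIdeal K B n := by
  have key : commutatorIdeal K A n ≤ (commutatorIdeal K B n).comap φ :=
    commutatorIdeal_le_iff.2 fun l hl => mem_commutatorIdeal (map_mem_lowerCentral φ hl)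
  exact key hx

theorem map_iterCommutator (φ : A →ₐ[K] B) (x : ℕ → A) (n : ℕ) :
    φ (iterCommutator x n) = iterCommutator (φ ∘ x) n := by
  induction n using iterCommutator.induct with
  | case1 => exact map_zero φ
  | case2 => rfl
  | case3 n ih => rw [iterCommutator, iterCommutator, map_lie_ring, ih, Function.comp_apply]

theorem iterCommutator_congr {R : Type*} [Ring R] {x y : ℕ → R} {n : ℕ}
    (h : ∀ k < n, x k = y k) : iterCommutator x n = iterCommutator y n := by
  induction n using iterCommutator.induct with
  | case1 => rfl
  | case2 => exact h 0 zero_lt_one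
  | case3 n ih =>
    rw [iterCommutator, iterCommutator, ih fun k hk => h k (hk.trans (Nat.lt_succ_self _)),
      h (n + 1) (Nat.lt_succ_self _)]

theorem iterCommutator_mem_lowerCentral (x : ℕ → A) (n : ℕ) :
    iterCommutator x (n + 1) ∈ lowerCentral K A n := by
  induction n with
  | zero => exact mem_lowerCentral_zero _
  | succ n ih => exact lie_mem_lowerCentral ih _

theorem lowerCentral_le_span_iterCommutator (n : ℕ) :
    lowerCentral K A n ≤ Submodule.span K (Set.range fun x : ℕ → A => iterCommutator x (n + 1)) := by
  induction n with
  | zero => exact fun a _ => Submodule.subset_span ⟨fun _ => a, rfl⟩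
  | succ n ih =>
    refine lowerCentral_succ_le_iff.2 fun l hl a => ?_
    have key : Submodule.span K (Set.range fun x : ℕ → A => iterCommutator x (n + 1)) ≤
        (Submodule.span K (Set.range fun x : ℕ → A => iterCommutator x (n + 1 + 1))).comap
          (lieRight K a) := by
      refine Submodule.span_le.2 ?_
      rintro _ ⟨x, rfl⟩
      refine Submodule.subset_span ⟨Function.update x (n + 1) a, ?_⟩
      have h : iterCommutator (Function.update x (n + 1) a) (n + 1) = iterCommutator x (n + 1) :=
        iterCommutator_congr fun k hk => Function.update_of_ne hk.ne _ _
      change ⁅iterCommutator (Function.update x (n + 1) a) (n + 1), _⁆ = _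
      rw [h, Function.update_self, lieRight_apply]
    exact key (ih hl)

theorem iterCommutator_ι_mem_T (n : ℕ) : iterCommutator (FreeAlgebra.ι K) n ∈ T K n := by
  rw [T, tIdealSpan, TwoSidedIdeal.mem_sInf]
  exact fun I hI => hI.2 _ rfl

theorem T_le_commutatorIdeal (n : ℕ) :
    T K (n + 1) ≤ (commutatorIdeal K (FreeAlgebra K ℕ) n).toTwoSided := by
  refine sInf_le ⟨fun φ f hf => ?_, ?_⟩
  · rw [Ideal.mem_toTwoSided] at hf ⊢
    exact map_mem_commutatorIdeal φ hf
  · rintro _ rfl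
    rw [Ideal.mem_toTwoSided]
    exact mem_commutatorIdeal (iterCommutator_mem_lowerCentral _ n)

/-- `T⁽ⁿ⁺¹⁾(A)` is the left ideal generated by the `n`-th term of the lower central series. -/
theorem TOf_asIdeal (n : ℕ) : (TOf K A (n + 1)).asIdeal = commutatorIdeal K A n := by
  apply le_antisymm
  · have h : TOf K A (n + 1) ≤ (commutatorIdeal K A n).toTwoSided := by
      refine TwoSidedIdeal.span_le.2 ?_
      rintro _ ⟨f, hf, φ, rfl⟩
      have := T_le_commutatorIdeal n hf
      rw [Ideal.mem_toTwoSided] at this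
      exact Ideal.mem_toTwoSided.2 (map_mem_commutatorIdeal φ this)
    exact fun x hx => Ideal.mem_toTwoSided.1 (h (TwoSidedIdeal.mem_asIdeal.1 hx))
  · have h : Submodule.span K (Set.range fun x : ℕ → A => iterCommutator x (n + 1)) ≤
        (TOf K A (n + 1)).asIdeal.restrictScalars K := by
      refine Submodule.span_le.2 ?_
      rintro _ ⟨x, rfl⟩
      refine TwoSidedIdeal.subset_span ⟨_, iterCommutator_ι_mem_T (n + 1), FreeAlgebra.lift K x, ?_⟩
      rw [map_iterCommutator, FreeAlgebra.ι_comp_lift]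
    exact commutatorIdeal_le_iff.2 fun l hl => h (lowerCentral_le_span_iterCommutator n hl)

end TIdeals

end LowerCentral

/-! ### The exterior algebra as counterexample -/

section Grassmann

variable {K : Type*} [Field K] {V : Type*} [AddCommGroup V] [Module K V]

open CliffordAlgebra in
theorem commute_of_mem_even {x : ExteriorAlgebra K V} (hx : x ∈ evenOdd (0 : QuadraticForm K V) 0)
    (y : ExteriorAlgebra K V) : Commute x y := by
  have hι (u v : V) : ExteriorAlgebra.ι K u * ExteriorAlgebra.ι K v =
      -(ExteriorAlgebra.ι K v * ExteriorAlgebra.ι K u) :=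
    eq_neg_of_add_eq_zero_left (ExteriorAlgebra.ι_add_mul_swap u v)
  have h (u v w : V) : Commute (ExteriorAlgebra.ι K u * ExteriorAlgebra.ι K v)
      (ExteriorAlgebra.ι K w) := by
    rw [Commute, SemiconjBy, mul_assoc, hι v w, mul_neg, ← mul_assoc, hι u w, neg_mul, neg_neg,
      mul_assoc]
  have hw (w : V) : Commute x (ExteriorAlgebra.ι K w) := by
    induction x, hx using even_induction with
    | algebraMap r => exact Algebra.commutes r _
    | add x y _ _ hx hy => exact hx.add_left hy
    | ι_mul_ι_mul u v x _ hx => exact (h u v w).mul_left hx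
  induction y using ExteriorAlgebra.induction with
  | algebraMap r => exact (Algebra.commutes r x).symm
  | ι w => exact hw w
  | mul a b ha hb => exact ha.mul_right hb
  | add a b ha hb => exact ha.add_right hb

open CliffordAlgebra in
-- Even elements are central, so a commutator only sees the odd parts of its arguments, and products
-- of odd elements are even.
theorem commute_lie_exterior (x y z : ExteriorAlgebra K V) : Commute ⁅x, y⁆ z := by
  have hdec (x : ExteriorAlgebra K V) : ∃ a ∈ evenOdd (0 : QuadraticForm K V) 0,
      ∃ b ∈ evenOdd (0 : QuadraticForm K V) 1, a + b = x := by
    refine Submodule.mem_sup.1 ?_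
    rw [(evenOdd_isCompl (0 : QuadraticForm K V)).sup_eq_top]
    exact Submodule.mem_top
  obtain ⟨a, ha, b, hb, rfl⟩ := hdec x
  obtain ⟨c, hc, d, hd, rfl⟩ := hdec y
  have h : ⁅a + b, c + d⁆ = b * d - d * b := by
    have h₁ := (commute_of_mem_even ha (c + d)).eq
    have h₂ := (commute_of_mem_even hc b).eq
    rw [Ring.lie_def, add_mul, h₁, mul_add b, ← h₂]
    noncomm_ring
  rw [h]
  have hodd {u v : ExteriorAlgebra K V} (hu : u ∈ evenOdd (0 : QuadraticForm K V) 1)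
      (hv : v ∈ evenOdd (0 : QuadraticForm K V) 1) : u * v ∈ evenOdd (0 : QuadraticForm K V) 0 :=
    evenOdd_mul_le (0 : QuadraticForm K V) 1 1 (Submodule.mul_mem_mul hu hv)
  exact commute_of_mem_even (sub_mem (hodd hb hd) (hodd hd hb)) z

theorem commutatorIdeal_exterior : commutatorIdeal K (ExteriorAlgebra K V) 2 = ⊥ := by
  have h : lowerCentral K (ExteriorAlgebra K V) 2 ≤ ⊥ := by
    refine lowerCentral_succ_le_iff.2 fun l hl a => ?_
    have key : lowerCentral K (ExteriorAlgebra K V) 1 ≤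
        (⊥ : Submodule K (ExteriorAlgebra K V)).comap (lieRight K a) := by
      refine lowerCentral_succ_le_iff.2 fun x _ y => ?_
      exact sub_eq_zero.2 (commute_lie_exterior x y a).eq
    exact key hl
  exact le_bot_iff.1 (commutatorIdeal_le_iff.2 fun l hl => h hl)

theorem ι_mul_ι_mul_ι_mul_ι_ne_zero :
    ExteriorAlgebra.ι K (Pi.single 0 1 : Fin 4 → K) * ExteriorAlgebra.ι K (Pi.single 1 1) *
      (ExteriorAlgebra.ι K (Pi.single 2 1) * ExteriorAlgebra.ι K (Pi.single 3 1)) ≠ 0 := by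
  intro h
  let e : Fin 4 → Fin 4 → K := fun i => Pi.single i 1
  -- The determinant in degree 4 and zero elsewhere: the induced functional takes the value 1 on
  -- `e₀e₁e₂e₃`.
  let f : ∀ i, (Fin 4 → K) [⋀^Fin i]→ₗ[K] K :=
    Function.update 0 4 (Matrix.detRowAlternating : (Fin 4 → K) [⋀^Fin 4]→ₗ[K] K)
  have h1 : ExteriorAlgebra.ιMulti K 4 e = 0 := by
    rw [← h]
    simp only [ExteriorAlgebra.ιMulti_apply, List.ofFn_succ, List.ofFn_zero, List.prod_cons,
      List.prod_nil, mul_one, mul_assoc]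
    rfl
  have h2 := ExteriorAlgebra.liftAlternating_apply_ιMulti f e
  rw [h1, map_zero] at h2
  have h4 : f 4 e = 1 := by
    have : e = (1 : Matrix (Fin 4) (Fin 4) K) := by
      ext i j
      simp [e, Matrix.one_apply, Pi.single_apply, eq_comm]
    simp only [f, Function.update_self]
    rw [this]
    exact Matrix.det_one
  exact zero_ne_one (h2.trans h4)

theorem lie_ι_mul_lie_ι_ne_zero (h2 : (2 : K) ≠ 0) :
    ⁅ExteriorAlgebra.ι K (Pi.single 0 1 : Fin 4 → K), ExteriorAlgebra.ι K (Pi.single 1 1 : Fin 4 → K)⁆ *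
      ⁅ExteriorAlgebra.ι K (Pi.single 2 1 : Fin 4 → K), ExteriorAlgebra.ι K (Pi.single 3 1 : Fin 4 → K)⁆ ≠
        0 := by
  have h (u v : Fin 4 → K) : ⁅ExteriorAlgebra.ι K u, ExteriorAlgebra.ι K v⁆ =
      (2 : K) • (ExteriorAlgebra.ι K u * ExteriorAlgebra.ι K v) := by
    rw [Ring.lie_def, two_smul, sub_eq_add_neg, ← eq_neg_of_add_eq_zero_left
      (ExteriorAlgebra.ι_add_mul_swap u v)]
  rw [h, h, smul_mul_smul_comm]
  exact smul_ne_zero (mul_ne_zero h2 h2) ι_mul_ι_mul_ι_mul_ι_ne_zero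

end Grassmann

end LieNilpotent

/-! ### The main theorem -/

theorem mainTheorem1 {K : Type*} [Field K] [Infinite K]
    (h2 : ringChar K ≠ 2) (h3 : ringChar K ≠ 3) :
    -- the product theorem for algebras with three generators
    (∀ (A : Type*) [Ring A] [Algebra K A],
      (∃ a b c : A, Algebra.adjoin K {a, b, c} = ⊤) →
      ∀ m n : ℕ, 2 ≤ m → 2 ≤ n →
        (LieNilpotent.TOf K A m).asIdeal * (LieNilpotent.TOf K A n).asIdeal ≤
          (LieNilpotent.TOf K A (m + n - 1)).asIdeal) ∧
    -- `[x, y][z, t]` does not lie in `T⁽³⁾`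
    (⁅FreeAlgebra.ι K (0 : ℕ), FreeAlgebra.ι K (1 : ℕ)⁆ * 
        ⁅FreeAlgebra.ι K (2 : ℕ), FreeAlgebra.ι K (3 : ℕ)⁆ ∉
      LieNilpotent.T K 3) ∧
    -- so the inclusion fails, for `m = n = 2`, in the free algebra with four generators
    ¬ ((LieNilpotent.TOf K (FreeAlgebra K (Fin 4)) 2).asIdeal *
        (LieNilpotent.TOf K (FreeAlgebra K (Fin 4)) 2).asIdeal ≤
          (LieNilpotent.TOf K (FreeAlgebra K (Fin 4)) 3).asIdeal) := by
  have two_ne : (2 : K) ≠ 0 := Ring.two_ne_zero h2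
  have three_ne : (3 : K) ≠ 0 := by
    intro h
    have hd : ringChar K ∣ 3 := ringChar.dvd (by exact_mod_cast h)
    rcases (Nat.dvd_prime Nat.prime_three).1 hd with h1 | h1
    · exact CharP.ringChar_ne_one h1
    · exact h3 h1
  -- Indices are reduced modulo 4; only the values at 0, 1, 2, 3 matter.
  let e : ℕ → ExteriorAlgebra K (Fin 4 → K) := fun n =>
    ExteriorAlgebra.ι K (Pi.single (Fin.ofNat 4 n) 1)
  refine ⟨?_, fun h => ?_, fun h => ?_⟩
  · rintro A _ _ ⟨a, b, c, hx⟩ m n hm hn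
    obtain ⟨i, rfl⟩ : ∃ i, m = i + 1 := ⟨m - 1, by omega⟩
    obtain ⟨j, rfl⟩ : ∃ j, n = j + 1 := ⟨n - 1, by omega⟩
    rw [show i + 1 + (j + 1) - 1 = i + j + 1 by omega, LieNilpotent.TOf_asIdeal,
      LieNilpotent.TOf_asIdeal, LieNilpotent.TOf_asIdeal]
    exact LieNilpotent.commutatorIdeal_mul_le_add hx two_ne three_ne i j
  · have h' := LieNilpotent.map_mem_commutatorIdeal (FreeAlgebra.lift K e)
      (Ideal.mem_toTwoSided.1 (LieNilpotent.T_le_commutatorIdeal 2 h))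
    rw [LieNilpotent.commutatorIdeal_exterior, Ideal.mem_bot, map_mul, LieNilpotent.map_lie_ring,
      LieNilpotent.map_lie_ring] at h'
    simp only [FreeAlgebra.lift_ι_apply] at h'
    exact LieNilpotent.lie_ι_mul_lie_ι_ne_zero two_ne h'
  · rw [LieNilpotent.TOf_asIdeal, LieNilpotent.TOf_asIdeal] at h
    have hl (i j : Fin 4) : ⁅FreeAlgebra.ι K i, FreeAlgebra.ι K j⁆ ∈
        LieNilpotent.commutatorIdeal K (FreeAlgebra K (Fin 4)) 1 :=
      LieNilpotent.mem_commutatorIdeal (LieNilpotent.lie_mem_lowerCentral_one _ _)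
    have h' := LieNilpotent.map_mem_commutatorIdeal
      (FreeAlgebra.lift K fun i : Fin 4 => ExteriorAlgebra.ι K (Pi.single i 1 : Fin 4 → K))
      (h (Ideal.mul_mem_mul (hl 0 1) (hl 2 3)))
    rw [LieNilpotent.commutatorIdeal_exterior, Ideal.mem_bot, map_mul, LieNilpotent.map_lie_ring,
      LieNilpotent.map_lie_ring] at h'
    simp only [FreeAlgebra.lift_ι_apply] at h'
    exact LieNilpotent.lie_ι_mul_lie_ι_ne_zero two_ne h'
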